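/- Let $F_2$ be the free group with basis $\{a,b\}$, whose elements are identified with the reduced words over $\{a^{\pm1},b^{\pm1}\}$. Call $u\in F_2$ primitivity-blocking if for every automorphism $\varphi$ of $F_2$ the reduced word $u$ is not a (contiguous) subword of the cyclic reduction of $\varphi(a)$. Then there is an algorithm that decides, for a given word $u\in F_2$ of length $n$, whether or not $u$ is primitivity-blocking, and whose worst-case time complexity is $O(n^2)$. Here the algorithm is a multi-tape Turing machine (in the form of a machine with finitely many stacks over finite alphabets) whose input is the reduced word $u$, and time is its number of steps. -/

import Mathlib

/-- The word (group element) `v` is `w`-orbit-blocking: for no automorphism `φ` of the free group is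
the reduced word `v` a (contiguous) subword of the cyclic reduction of `φ w`. -/
def IsOrbitBlocking {α : Type*} [DecidableEq α] (w v : FreeGroup α) : Prop :=
  ∀ φ : FreeGroup α ≃* FreeGroup α,
    ¬ v.toWord <:+: FreeGroup.reduceCyclically (φ w).toWord

/-- A word `v` of `F_r = FreeGroup (Fin r)`, `r ≥ 1`, is primitivity-blocking if it is orbit-blocking
with respect to the first free generator; that is, `v` is not a subword of the cyclic reduction of
any primitive element. -/
def IsPrimitivityBlocking {r : ℕ} [NeZero r] (v : FreeGroup (Fin r)) : Prop :=
  IsOrbitBlocking (FreeGroup.of (0 : Fin r)) v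

/-! A primitive element of F₂ is, up to conjugation, a positive primitive word in which each letter
is given one fixed sign (`isSignedPrim_map_of`). This is checked on generators of Aut(F₂), which
Nielsen reduction provides (`mulAut_mem_of_generators`). Conversely each positive primitive p has a
q such that all p^k q are primitive. Hence u is not blocking exactly when no letter occurs in it
with both signs and its unsigned word is a factor of a power of a positive primitive word
(`isPrimitivityBlocking_iff`).

Such factors are recognised by undoing substitutions. A factor cannot contain both 00 and 11
(`IsPrimFactor.not_pair`). A word with neither square alternates and is a factor of a power of 01
(`isPrimFactor_of_alternating`). If only ii occurs, deleting one letter from each block of i inverts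
`insertBefore i` and preserves the property both ways (`isPrimFactor_trimBlocks_iff`).

Each round takes linear time on stacks and shortens the word, so the total time is quadratic
(`reaches_answer`). -/

open List

/-- The positive substitution fixing `i` and sending the other letter `c` to `i c`. -/
def insertBefore (i : Fin 2) (w : List (Fin 2)) : List (Fin 2) :=
  w.flatMap fun c => if c = i then [c] else [i, c]

/-- The positive words obtained from single letters by the substitutions `insertBefore i`. -/
inductive PosPrim : List (Fin 2) → Prop
  | letter (i : Fin 2) : PosPrim [i]
  | subst (i : Fin 2) {p : List (Fin 2)} (hp : PosPrim p) : PosPrim (insertBefore i p)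

/-- `w` is a factor of a power of a positive primitive word. -/
def IsPrimFactor (w : List (Fin 2)) : Prop :=
  ∃ p, PosPrim p ∧ ∃ k : ℕ, w <:+: (replicate k p).flatten

/-- Delete the last letter of every maximal block of letters `x` with `f x = i`. -/
def trimBlocks {α : Type*} (f : α → Fin 2) (i : Fin 2) : List α → List α
  | [] => []
  | c :: w => if f c = i ∧ w.head?.map f ≠ some i then trimBlocks f i w
      else c :: trimBlocks f i w

/-! ### Images of the positive substitutions -/

section Substitution

variable (i : Fin 2)

@[simp] theorem insertBefore_nil : insertBefore i [] = [] := rfl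

@[simp] theorem insertBefore_cons (c : Fin 2) (w : List (Fin 2)) :
    insertBefore i (c :: w) = (if c = i then [c] else [i, c]) ++ insertBefore i w := rfl

@[simp] theorem insertBefore_append (v w : List (Fin 2)) :
    insertBefore i (v ++ w) = insertBefore i v ++ insertBefore i w := by
  simp [insertBefore]

theorem insertBefore_pow (p : List (Fin 2)) (k : ℕ) :
    insertBefore i (replicate k p).flatten = (replicate k (insertBefore i p)).flatten := by
  induction k with
  | zero => rfl
  | succ k ih => simp [replicate_succ, ih]

theorem head?_insertBefore_append (w : List (Fin 2)) :
    (insertBefore i w ++ [i]).head? = some i := by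
  cases w with
  | nil => rfl
  | cons c w => by_cases h : c = i <;> simp [h]

theorem PosPrim.ne_nil {p : List (Fin 2)} (hp : PosPrim p) : p ≠ [] := by
  induction hp with
  | letter i => simp
  | subst i hp ih =>
    rename_i p
    cases p with
    | nil => exact absurd rfl ih
    | cons c p => by_cases h : c = i <;> simp [h]

theorem singleton_append_insertBefore_prefix (w : List (Fin 2)) :
    ∃ t, insertBefore i w ++ [i] = i :: t := by
  cases w with
  | nil => exact ⟨[], rfl⟩
  | cons c w => by_cases h : c = i <;> simp [h]

/-- The other letter is always preceded by `i` in an image of `insertBefore i`. -/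
theorem not_pair_infix_insertBefore {i j : Fin 2} (hij : j ≠ i) (w : List (Fin 2)) :
    ¬ [j, j] <:+: insertBefore i w ++ [i] := by
  induction w with
  | nil =>
    intro h
    have := h.length_le
    simp at this
  | cons c w ih =>
    obtain ⟨t, ht⟩ := singleton_append_insertBefore_prefix i w
    by_cases h : c = i
    · simp only [insertBefore_cons, h, if_true, cons_append, infix_cons_iff]
      rintro (h | h)
      · exact hij (by simpa using (cons_prefix_cons.1 h).1)
      · exact ih h
    · simp only [insertBefore_cons, h, if_false, cons_append, infix_cons_iff, nil_append]
      rintro (h | h | h)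
      · exact hij (by simpa using (cons_prefix_cons.1 h).1)
      · rw [ht] at h
        have h2 := (cons_prefix_cons.1 h).2
        exact hij (by simpa using (cons_prefix_cons.1 h2).1)
      · exact ih h

end Substitution

/-! ### Block trimming as the inverse of a substitution -/

section Trim

variable {α : Type*} (f : α → Fin 2) (i : Fin 2)

theorem trimBlocks_map (w : List α) :
    (trimBlocks f i w).map f = trimBlocks id i (w.map f) := by
  induction w with
  | nil => rfl
  | cons c w ih =>
    have : (w.map f).head? = w.head?.map f := by cases w <;> rfl
    simp only [trimBlocks, map_cons, this, id]
    split_ifs <;> simp_all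

theorem trimBlocks_sublist (w : List α) : trimBlocks f i w <+ w := by
  induction w with
  | nil => exact Sublist.refl _
  | cons c w ih =>
    simp only [trimBlocks]
    split_ifs
    · exact ih.cons _
    · exact ih.cons_cons _

theorem length_trimBlocks_lt {w : List α} (h : ∃ c ∈ w, f c = i) :
    (trimBlocks f i w).length < w.length := by
  induction w with
  | nil => simp at h
  | cons c w ih =>
    simp only [trimBlocks]
    split_ifs with hc
    · exact Nat.lt_succ_of_le (trimBlocks_sublist f i w).length_le
    · simp only [length_cons, add_lt_add_iff_right]
      refine ih ?_
      obtain ⟨x, hx, hxi⟩ := h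
      rcases mem_cons.1 hx with rfl | hx
      · cases w with
        | nil => simp [hxi] at hc
        | cons y w => exact ⟨y, by simp, by simpa [hxi] using hc⟩
      · exact ⟨x, hx, hxi⟩

theorem trimBlocks_suffix (v w : List α) : trimBlocks f i w <:+ trimBlocks f i (v ++ w) := by
  induction v with
  | nil => exact suffix_refl _
  | cons c v ih =>
    simp only [trimBlocks, cons_append]
    split_ifs
    · exact ih
    · exact ih.trans (suffix_cons _ _)

/-- Whether a letter is deleted depends only on it and its successor, so appending `w` affects only
the last letter of `v`, and can only turn its deletion into retention. -/
theorem trimBlocks_prefix (v w : List α) : trimBlocks f i v <+: trimBlocks f i (v ++ w) := by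
  induction v with
  | nil => exact nil_prefix
  | cons c v ih =>
    cases v with
    | nil =>
      by_cases h : f c = i <;> simp [trimBlocks, h]
    | cons d v =>
      have key : ∀ u, trimBlocks f i (c :: d :: u) = if f c = i ∧ some (f d) ≠ some i then
          trimBlocks f i (d :: u) else c :: trimBlocks f i (d :: u) := fun u => rfl
      rw [cons_append, cons_append, key, key, ← cons_append]
      split_ifs
      · exact ih
      · exact (prefix_cons_inj c).2 ih

theorem trimBlocks_infix {v w : List α} (h : v <:+: w) :
    trimBlocks f i v <:+: trimBlocks f i w := by
  obtain ⟨s, t, rfl⟩ := h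
  rw [append_assoc]
  exact (trimBlocks_prefix f i v t).isInfix.trans (trimBlocks_suffix f i s (v ++ t)).isInfix

/-- The substitution lengthens by one the (possibly empty) block of `i` before each other letter;
the appended `i` does the same for the final block. Trimming takes these letters away again. -/
theorem trimBlocks_insertBefore (w : List (Fin 2)) :
    trimBlocks id i (insertBefore i w ++ [i]) = w := by
  induction w with
  | nil => simp [trimBlocks]
  | cons c w ih =>
    have := head?_insertBefore_append i w
    by_cases h : c = i
    · simp only [insertBefore_cons, h, if_true, cons_append, nil_append,
        trimBlocks, this, ih]
      simp
    · simp only [insertBefore_cons, h, if_false, cons_append, nil_append,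
        trimBlocks, this, ih]
      simp [h]

/-- Without `j j`, every `j` except possibly an initial one is preceded by a nonempty block of `i`,
whose deleted letter the substitution puts back. An initial `j` acquires an extra `i` in front, and
the final `i` restores a trailing block. -/
theorem prefix_insertBefore_trimBlocks {w : List (Fin 2)}
    (hw : ∀ j, j ≠ i → ¬ [j, j] <:+: w) :
    (if w.head? = some i then w else i :: w) <+: insertBefore i (trimBlocks id i w) ++ [i] := by
  induction w with
  | nil => simp [trimBlocks]
  | cons c w ih =>
    have ih := ih fun j hj h => hw j hj (h.trans (suffix_cons _ _).isInfix)
    by_cases hc : c = i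
    · by_cases hi : w.head? = some i
      · simpa [trimBlocks, hc, hi] using ih
      · simpa [trimBlocks, hc, hi] using ih
    · cases w with
      | nil => simp [trimBlocks, hc]
      | cons d w =>
        have hd : d = i := by
          by_contra hd
          have : c = d := by omega
          exact hw c hc ⟨[], w, by simp [this]⟩
        simpa [trimBlocks, hc, hd] using ih

end Trim

/-! ### Recognising factors of powers of positive primitive words -/

theorem replicate_of_pair_free {i : Fin 2} {k : ℕ} {w : List (Fin 2)}
    (h : w <:+: (replicate k [i]).flatten) : w = replicate w.length i := by
  rw [eq_replicate_iff]
  refine ⟨rfl, fun b hb => ?_⟩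
  have := h.subset hb
  simp only [mem_flatten, mem_replicate] at this
  obtain ⟨l, ⟨-, rfl⟩, hl⟩ := this
  simpa using hl

/-- A factor of a power of a positive primitive word, in which `i i` occurs, is either a power of
`i` or a factor of an image of `insertBefore i`. -/
theorem IsPrimFactor.cases {w : List (Fin 2)} (hw : IsPrimFactor w) {i : Fin 2}
    (hi : [i, i] <:+: w) :
    (w = replicate w.length i) ∨
      ∃ p, PosPrim p ∧ ∃ k : ℕ, w <:+: insertBefore i (replicate k p).flatten ++ [i] := by
  obtain ⟨p, hp, k, hk⟩ := hw
  cases hp with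
  | letter j =>
    left
    have h1 := replicate_of_pair_free hk
    have : i ∈ w := hi.subset (by simp)
    rw [h1] at this
    rw [(mem_replicate.1 this).2]
    exact h1
  | subst j hp =>
    rename_i p
    rw [← insertBefore_pow] at hk
    have hk' := hk.trans (prefix_append _ [j]).isInfix
    by_cases hij : i = j
    · subst hij
      exact Or.inr ⟨p, hp, k, hk'⟩
    · exact absurd (hi.trans hk') (not_pair_infix_insertBefore hij _)

theorem IsPrimFactor.not_pair {w : List (Fin 2)} (hw : IsPrimFactor w) {i j : Fin 2}
    (hij : j ≠ i) (hi : [i, i] <:+: w) : ¬ [j, j] <:+: w := by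
  intro hj
  rcases hw.cases hi with h | ⟨p, -, k, hk⟩
  · have : j ∈ w := hj.subset (by simp)
    rw [h] at this
    exact hij (mem_replicate.1 this).2
  · exact not_pair_infix_insertBefore hij _ (hj.trans hk)

/-- Trimming respects factors and undoes `insertBefore i`, which gives one direction; re-inserting
the deleted letters gives the other. This is the recursion step of the algorithm. -/
theorem isPrimFactor_trimBlocks_iff {w : List (Fin 2)} {i : Fin 2} (hi : [i, i] <:+: w)
    (hj : ∀ j, j ≠ i → ¬ [j, j] <:+: w) :
    IsPrimFactor (trimBlocks id i w) ↔ IsPrimFactor w := by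
  constructor
  · rintro ⟨p, hp, k, hk⟩
    -- The extra copy of `p` absorbs the appended `i`, since a nonempty image of `insertBefore i`
    -- begins with `i`.
    refine ⟨insertBefore i p, hp.subst i, k + 1, ?_⟩
    have h1 : w <:+: insertBefore i (trimBlocks id i w) ++ [i] := by
      have := prefix_insertBefore_trimBlocks i hj
      split_ifs at this
      · exact this.isInfix
      · exact (suffix_cons _ _).isInfix.trans this.isInfix
    refine h1.trans ?_
    obtain ⟨s, t, hst⟩ := hk
    rw [← insertBefore_pow, replicate_succ', flatten_append, ← hst]
    obtain ⟨u, hu⟩ := singleton_append_insertBefore_prefix i (t ++ p)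
    have hne : ∃ v, insertBefore i (t ++ p) = i :: v := by
      have : t ++ p ≠ [] := by simp [hp.ne_nil]
      cases h : t ++ p with
      | nil => exact absurd h this
      | cons c l => by_cases hc : c = i <;> simp [hc]
    obtain ⟨v, hv⟩ := hne
    refine ⟨insertBefore i s, v, ?_⟩
    simp only [append_assoc, flatten_cons, flatten_nil, append_nil, insertBefore_append] at hv ⊢
    rw [hv]
    simp
  · intro hw
    rcases hw.cases hi with h | ⟨p, hp, k, hk⟩
    · refine ⟨[i], .letter i, w.length, ?_⟩
      have : (replicate w.length [i]).flatten = w := by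
        conv_rhs => rw [h]
        simp
      rw [this]
      have h2 := trimBlocks_infix id i (w := w ++ [i]) (v := w) (prefix_append _ _).isInfix
      refine h2.trans ?_
      have h3 : insertBefore i w = w := by
        rw [h]
        generalize w.length = n
        induction n with
        | zero => rfl
        | succ n ih => simp [replicate_succ, ih]
      have h4 := trimBlocks_insertBefore i w
      rw [h3] at h4
      rw [h4]
    · refine ⟨p, hp, k, ?_⟩
      have := trimBlocks_infix id i hk
      rwa [trimBlocks_insertBefore] at this

theorem alternating_prefix {w : List (Fin 2)} (hw : ∀ j, ¬ [j, j] <:+: w) :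
    (if w.head? = some 1 then 0 :: w else w) <+: (replicate (w.length + 1) [0, 1]).flatten := by
  induction w with
  | nil => simp
  | cons c w ih =>
    have ih := ih fun j h => hw j (h.trans (suffix_cons _ _).isInfix)
    have hc : w.head? ≠ some c := by
      intro h
      cases w with
      | nil => simp at h
      | cons d w =>
        simp at h
        exact hw c ⟨[], w, by simp [h]⟩
    obtain rfl | rfl : c = 0 ∨ c = 1 := by omega
    · cases w with
      | nil => simp
      | cons d w =>
        have hd : d = 1 := by simp at hc; omega
        subst hd
        rw [if_pos (by simp)] at ih
        rw [if_neg (by simp)]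
        refine ih.trans ?_
        rw [length_cons (a := 0), replicate_succ' (n := (1 :: w).length + 1), flatten_append]
        exact prefix_append _ _
    · rw [if_neg hc] at ih
      simpa [replicate_succ] using ih

theorem isPrimFactor_of_alternating {w : List (Fin 2)} (hw : ∀ j, ¬ [j, j] <:+: w) :
    IsPrimFactor w := by
  refine ⟨insertBefore 0 [1], (PosPrim.letter 1).subst 0, w.length + 1, ?_⟩
  have := alternating_prefix hw
  split_ifs at this
  · exact (suffix_cons _ _).isInfix.trans this.isInfix
  · exact this.isInfix

/-! ### Common prefixes and cancellation in free groups -/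

section CommonPrefix

variable {β : Type*} [DecidableEq β]

/-- The length of the longest common prefix of two lists. -/
def commonPrefixLength : List β → List β → ℕ
  | a :: l, b :: m => if a = b then commonPrefixLength l m + 1 else 0
  | _, _ => 0

theorem le_commonPrefixLength_iff {n : ℕ} {l m : List β} :
    n ≤ commonPrefixLength l m ↔ n ≤ l.length ∧ n ≤ m.length ∧ l.take n = m.take n := by
  induction l generalizing m n with
  | nil => cases n <;> simp [commonPrefixLength]
  | cons a l ih =>
    cases m with
    | nil => cases n <;> simp [commonPrefixLength]
    | cons b m =>
      cases n with
      | zero => simp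
      | succ n =>
        by_cases h : a = b
        · simp [commonPrefixLength, h, ih]
        · simp [commonPrefixLength, h]

theorem exists_common_prefix (l m : List β) :
    ∃ p l' m', l = p ++ l' ∧ m = p ++ m' ∧ p.length = commonPrefixLength l m ∧
      ∀ a ∈ l'.head?, ∀ b ∈ m'.head?, a ≠ b := by
  induction l generalizing m with
  | nil => exact ⟨[], [], m, by simp [commonPrefixLength]⟩
  | cons a l ih =>
    cases m with
    | nil => exact ⟨[], a :: l, [], by simp [commonPrefixLength]⟩
    | cons b m =>
      by_cases h : a = b
      · obtain ⟨p, l', m', h1, h2, h3, h4⟩ := ih m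
        exact ⟨a :: p, l', m', by simp [← h1], by simp [← h2, h], by
          simp [commonPrefixLength, h, h3], h4⟩
      · exact ⟨[], a :: l, b :: m, by simp [commonPrefixLength, h]⟩

end CommonPrefix

namespace FreeGroup

variable {α : Type*}

theorem eq_flip_of_ne {l m : α × Bool} (h : l.1 = m.1) (hne : l ≠ m) : l = (m.1, !m.2) := by
  obtain ⟨i, b⟩ := l
  obtain ⟨j, c⟩ := m
  obtain rfl : i = j := h
  cases b <;> cases c <;> simp_all

theorem mk_cons (l : α × Bool) (L : List (α × Bool)) : mk (l :: L) = mk [l] * mk L := by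
  rw [mul_mk]; rfl

theorem mk_singleton_inv (l : α × Bool) : (mk [l])⁻¹ = mk [(l.1, !l.2)] := by
  rw [inv_mk]; simp [FreeGroup.invRev]

theorem mk_letter (l : α × Bool) : mk [l] = bif l.2 then of l.1 else (of l.1)⁻¹ := by
  obtain ⟨i, b⟩ := l
  cases b <;> rfl

theorem lift_sign_comp_self (s : α → Bool) :
    (lift fun j => mk [(j, s j)]).comp (lift fun j => mk [(j, s j)]) =
      MonoidHom.id (FreeGroup α) := by
  ext j
  rw [MonoidHom.comp_apply, lift_apply_of, mk_letter, MonoidHom.id_apply]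
  cases h : s j <;> simp [mk_letter, h]

/-- Sends `of i` to `of i` or `(of i)⁻¹` according to `s i`. -/
def signAut (s : α → Bool) : MulAut (FreeGroup α) :=
  MonoidHom.toMulEquiv (lift fun j => mk [(j, s j)]) (lift fun j => mk [(j, s j)])
    (lift_sign_comp_self s) (lift_sign_comp_self s)

theorem signAut_of (s : α → Bool) (j : α) : signAut s (of j) = mk [(j, s j)] := by
  simp [signAut]

theorem signAut_mul_self (s : α → Bool) : signAut s * signAut s = 1 :=
  MulEquiv.ext fun x => (signAut s).symm_apply_apply x

variable [DecidableEq α]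

theorem IsReduced.invRev {L : List (α × Bool)} (h : IsReduced L) : IsReduced (invRev L) := by
  rw [isReduced_iff_reduce_eq] at h ⊢
  rw [reduce_invRev, h]

theorem toWord_mk_of_isReduced {L : List (α × Bool)} (h : IsReduced L) : (mk L).toWord = L := by
  rw [toWord_mk, h.reduce_eq]

/-- The Gromov product at `1` in the Cayley tree. -/
def gromovProduct (x y : FreeGroup α) : ℕ := commonPrefixLength x.toWord y.toWord

theorem le_gromovProduct_iff {n : ℕ} {x y : FreeGroup α} :
    n ≤ gromovProduct x y ↔ n ≤ norm x ∧ n ≤ norm y ∧ x.toWord.take n = y.toWord.take n :=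
  le_commonPrefixLength_iff

theorem gromovProduct_comm (x y : FreeGroup α) : gromovProduct x y = gromovProduct y x := by
  refine eq_of_forall_le_iff fun n => ?_
  simp only [le_gromovProduct_iff]
  tauto

/-- The ultrametric inequality expressing that the Cayley tree is 0-hyperbolic. -/
theorem le_gromovProduct_trans {n : ℕ} {x y z : FreeGroup α} (h1 : n ≤ gromovProduct x y)
    (h2 : n ≤ gromovProduct y z) : n ≤ gromovProduct x z := by
  rw [le_gromovProduct_iff] at *
  exact ⟨h1.1, h2.2.1, h1.2.2.trans h2.2.2⟩

/-- In `x⁻¹ * y` exactly the longest common prefix cancels: what remains on the two sides starts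
with different letters. -/
theorem norm_inv_mul_add (x y : FreeGroup α) :
    norm (x⁻¹ * y) + 2 * gromovProduct x y = norm x + norm y := by
  obtain ⟨p, l, m, hl, hm, hp, hne⟩ := exists_common_prefix x.toWord y.toWord
  have hx : IsReduced (p ++ l) := hl ▸ isReduced_toWord
  have hy : IsReduced (p ++ m) := hm ▸ isReduced_toWord
  have h1 : IsReduced (invRev l ++ m) := by
    have a1 : IsReduced (FreeGroup.invRev l) := (hx.infix ⟨p, [], by simp⟩).invRev
    have a2 : IsReduced m := hy.infix ⟨p, [], by simp⟩
    refine isChain_append.2 ⟨a1, a2, fun a ha b hb hab => ?_⟩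
    cases l with
    | nil => simp at ha
    | cons c l =>
      rw [invRev_cons] at ha
      simp [FreeGroup.invRev] at ha
      have := hne c (by simp) b hb
      subst ha
      by_contra h
      exact this (Prod.ext hab (by simpa using h))
  have h2 : x⁻¹ * y = mk (FreeGroup.invRev l ++ m) := by
    rw [← mk_toWord (x := x), ← mk_toWord (x := y), hl, hm, ← mul_mk, ← mul_mk, ← mul_mk, ← inv_mk]
    group
  have h3 : norm (x⁻¹ * y) = l.length + m.length := by
    rw [norm, h2, toWord_mk_of_isReduced h1]
    simp
  rw [h3, gromovProduct, ← hp, norm, norm, hl, hm]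
  simp
  omega

/-- With x = k c k⁻¹ and c cyclically reduced and nonempty, x² = k c c k⁻¹ is already reduced. -/
theorem norm_lt_norm_sq {x : FreeGroup α} (hx : x ≠ 1) : norm x < norm (x * x) := by
  have h1 := reduceCyclically.reduce_flatten_replicate_succ (isReduced_toWord (x := x)) 1
  rw [← toWord_pow] at h1
  have h2 := reduceCyclically.conj_conjugator_reduceCyclically x.toWord
  have h3 : reduceCyclically x.toWord ≠ [] := by
    intro h
    rw [h] at h2
    apply hx
    rw [← mk_toWord (x := x), ← h2]
    simp [← mul_mk, ← inv_mk]
  have h4 := length_pos_iff.2 h3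
  rw [← pow_two, norm, norm, h1]
  conv_lhs => rw [← h2]
  simp [replicate_succ]
  omega

theorem two_mul_gromovProduct_inv_lt {x : FreeGroup α} (hx : x ≠ 1) :
    2 * gromovProduct x x⁻¹ < norm x := by
  have h1 := norm_inv_mul_add x⁻¹ x
  have h2 := norm_lt_norm_sq hx
  rw [inv_inv, norm_inv_eq, gromovProduct_comm] at h1
  omega

/-- The Nielsen condition on a family `X` of elements, indexed by the letters and compatible with
inversion: in products of members some letter of each factor survives. -/
def IsNielsenReduced (X : α × Bool → FreeGroup α) : Prop :=
  ∀ l m n : α × Bool, m ≠ l → n ≠ (l.1, !l.2) →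
    gromovProduct (X l) (X m) + gromovProduct (X l)⁻¹ (X n) < norm (X l)

/-- A letter of the first factor survives the cancellations on both of its sides, so another
letter's image overlaps the whole product only as far as it overlaps the first factor. The Gromov
product in the bound strengthens the induction: it pays for the cancellation when a further factor
is put in front. -/
theorem IsNielsenReduced.le_norm {φ : FreeGroup α →* FreeGroup α}
    (hN : IsNielsenReduced fun l => φ (mk [l])) (l : α × Bool) (L : List (α × Bool))
    (hL : IsReduced (l :: L)) (n : α × Bool) (hn : n ≠ l) :
    gromovProduct (φ (mk [n])) (φ (mk (l :: L))) = gromovProduct (φ (mk [n])) (φ (mk [l])) ∧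
      (l :: L).length + gromovProduct (φ (mk [n])) (φ (mk [l])) ≤ norm (φ (mk (l :: L))) := by
  induction L generalizing l n with
  | nil =>
    refine ⟨rfl, ?_⟩
    have := hN l n l hn (fun h => by simpa using congrArg Prod.snd h)
    simp only at this
    have h2 := gromovProduct_comm (φ (mk [n])) (φ (mk [l]))
    simp only [length_cons, length_nil]
    omega
  | cons k L ih =>
    rw [IsReduced, isChain_cons_cons] at hL
    have hk : (l.1, !l.2) ≠ k := by
      rintro rfl
      simpa using hL.1 rfl
    obtain ⟨e1, e2⟩ := ih k hL.2 _ hk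
    set g' := φ (mk (k :: L)) with hg'
    have hg : φ (mk (l :: k :: L)) = φ (mk [l]) * g' := by rw [mk_cons, _root_.map_mul]
    rw [← mk_singleton_inv, _root_.map_inv] at e1 e2
    rw [hg]
    set x := φ (mk [l]) with hx
    have e3 := norm_inv_mul_add x⁻¹ g'
    rw [inv_inv, norm_inv_eq, e1] at e3
    have e4 := norm_inv_mul_add x (x * g')
    rw [inv_mul_cancel_left] at e4
    have e5 := hN l n k hn hk.symm
    simp only [← hx] at e5
    -- `x * g'` retains the part of `x` that `g'` does not cancel, which is longer than what `x`
    -- shares with the image of `n`; the ultrametric inequality then gives `e7`.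
    have e6 : gromovProduct x (φ (mk [n])) < gromovProduct x (x * g') := by omega
    have e7 : gromovProduct (φ (mk [n])) (x * g') = gromovProduct (φ (mk [n])) x := by
      apply le_antisymm
      · by_contra! h
        rw [gromovProduct_comm _ x] at h
        have a1 : gromovProduct x (φ (mk [n])) + 1 ≤ gromovProduct (φ (mk [n])) (x * g') := h
        have a2 : gromovProduct x (φ (mk [n])) + 1 ≤ gromovProduct (x * g') x := by
          rw [gromovProduct_comm _ x]; exact e6
        have := le_gromovProduct_trans a1 a2
        rw [gromovProduct_comm _ x] at this
        omega
      · refine le_gromovProduct_trans le_rfl ?_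
        rw [gromovProduct_comm _ x]
        exact e6.le
    refine ⟨e7, ?_⟩
    rw [gromovProduct_comm _ x]
    simp only [length_cons] at e2 ⊢
    omega

/-! ### Elementary automorphisms -/

section Automorphisms

/-- Fixes `of i` and multiplies all other generators on the left by `of i`. -/
def transvection (i : α) : MulAut (FreeGroup α) :=
  MonoidHom.toMulEquiv (lift fun j => if j = i then of j else of i * of j)
    (lift fun j => if j = i then of j else (of i)⁻¹ * of j)
    (by ext j; by_cases h : j = i <;> simp [h])
    (by ext j; by_cases h : j = i <;> simp [h])

theorem transvection_of (i j : α) :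
    transvection i (of j) = if j = i then of j else of i * of j := by
  simp [transvection]

theorem transvection_inv_of (i j : α) :
    (transvection i)⁻¹ (of j) = if j = i then of j else (of i)⁻¹ * of j := by
  change (MonoidHom.toMulEquiv _ _ _ _).symm _ = _
  simp [MonoidHom.toMulEquiv]

/-- Exchanges the two generators. -/
def swapAut : MulAut (FreeGroup (Fin 2)) := freeGroupCongr (Equiv.swap 0 1)

theorem swapAut_of (j : Fin 2) : swapAut (of j) = of (Equiv.swap 0 1 j) := by
  simp [swapAut]

theorem swapAut_mul_self : swapAut * swapAut = 1 := by
  refine MulEquiv.ext fun x => ?_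
  change ((swapAut * swapAut : MulAut _) : FreeGroup (Fin 2) →* FreeGroup (Fin 2)) x =
    MonoidHom.id _ x
  congr 1
  ext j
  simp [swapAut]

end Automorphisms

/-! ### Nielsen reduction in rank two -/

section Nielsen

theorem norm_map_letter_eq (φ : FreeGroup (Fin 2) →* FreeGroup (Fin 2)) (l : Fin 2 × Bool) :
    norm (φ (mk [l])) = norm (φ (of l.1)) := by
  obtain ⟨i, b⟩ := l
  cases b
  · have : mk [(i, false)] = (of i)⁻¹ := by simp [of, FreeGroup.invRev]
    rw [this, _root_.map_inv, norm_inv_eq]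
  · rfl

theorem exists_signed_perm (l m : Fin 2 × Bool) (h : l.1 ≠ m.1) :
    ∃ ν : MulAut (FreeGroup (Fin 2)), ν (of 0) = mk [l] ∧ ν (of 1) = mk [m] ∧
      ∀ G : Submonoid (MulAut (FreeGroup (Fin 2))), (∀ s, signAut s ∈ G) → swapAut ∈ G →
        ν⁻¹ ∈ G := by
  obtain ⟨i, b⟩ := l
  obtain ⟨j, c⟩ := m
  have hs := fun s : Fin 2 → Bool => inv_eq_of_mul_eq_one_left (signAut_mul_self s)
  by_cases hi : i = 0
  · have hj : j = 1 := by simp at h; omega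
    subst hi hj
    refine ⟨signAut ![b, c], by simp [signAut_of], by simp [signAut_of], fun G h1 h2 => ?_⟩
    rw [hs]
    exact h1 _
  · have hi : i = 1 := by omega
    have hj : j = 0 := by simp at h; omega
    subst hi hj
    refine ⟨signAut ![c, b] * swapAut, ?_, ?_, fun G h1 h2 => ?_⟩
    · simp [swapAut_of, signAut_of]
    · simp [swapAut_of, signAut_of]
    · rw [mul_inv_rev, hs, inv_eq_of_mul_eq_one_left swapAut_mul_self]
      exact mul_mem h2 (h1 _)

/-- Minimality with `c = 1` bounds each overlap by half the length of the factor. The condition can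
thus fail only when a factor U is cancelled by exactly half from both sides; allowing a conjugation
`c` excludes this case too, with no need for a well-ordering of words. -/
theorem isNielsenReduced_of_minimal (φ : MulAut (FreeGroup (Fin 2)))
    (hmove : ∀ (l m : Fin 2 × Bool) (c : FreeGroup (Fin 2)), l.1 ≠ m.1 →
      norm (φ (mk [l])) + norm (φ (mk [m])) ≤ norm (c * φ (mk [l]) * c⁻¹) +
        norm (c * ((φ (mk [l]))⁻¹ * φ (mk [m])) * c⁻¹)) :
    IsNielsenReduced fun l => φ.toMonoidHom (mk [l]) := by
  have hhalf : ∀ l m : Fin 2 × Bool, l.1 ≠ m.1 →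
      2 * gromovProduct (φ (mk [l])) (φ (mk [m])) ≤ norm (φ (mk [l])) := by
    intro l m h
    have h1 := hmove l m 1 h
    have h2 := norm_inv_mul_add (φ (mk [l])) (φ (mk [m]))
    simp only [one_mul, inv_one, mul_one] at h1
    omega
  have hne : ∀ l, φ (mk [l]) ≠ 1 := by
    intro l h
    rw [map_eq_one_iff φ φ.injective, ← toWord_eq_nil_iff, toWord_mk, reduce_singleton] at h
    simp at h
  have hinv : ∀ l : Fin 2 × Bool, (φ (mk [l]))⁻¹ = φ (mk [(l.1, !l.2)]) := fun l => by
    rw [← mk_singleton_inv, _root_.map_inv]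
  intro l m n hm hn
  simp only [MulEquiv.toMonoidHom_eq_coe, MonoidHom.coe_coe]
  have hself := two_mul_gromovProduct_inv_lt (hne l)
  have hB : 2 * gromovProduct (φ (mk [l])) (φ (mk [m])) ≤ norm (φ (mk [l])) ∧
      (m.1 = l.1 → 2 * gromovProduct (φ (mk [l])) (φ (mk [m])) < norm (φ (mk [l]))) := by
    by_cases h : l.1 = m.1
    · have : m = (l.1, !l.2) := by
        refine Prod.ext h.symm ?_
        by_contra h'
        exact hm (Prod.ext h.symm (by simpa using h'))
      rw [this, ← hinv]
      exact ⟨hself.le, fun _ => hself⟩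
    · exact ⟨hhalf l m h, fun h' => absurd h'.symm h⟩
  have hB' : 2 * gromovProduct (φ (mk [l]))⁻¹ (φ (mk [n])) ≤ norm (φ (mk [l])) ∧
      (n.1 = l.1 → 2 * gromovProduct (φ (mk [l]))⁻¹ (φ (mk [n])) < norm (φ (mk [l]))) := by
    by_cases h : l.1 = n.1
    · have : n = l := by
        refine Prod.ext h.symm ?_
        by_contra h'
        exact hn (Prod.ext h.symm (by cases h1 : n.2 <;> cases h2 : l.2 <;> simp_all))
      rw [this, gromovProduct_comm]
      exact ⟨hself.le, fun _ => hself⟩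
    · refine ⟨?_, fun h' => absurd h'.symm h⟩
      have := hhalf (l.1, !l.2) n h
      rwa [← hinv, norm_inv_eq] at this
  by_contra! hcon
  have hml : l.1 ≠ m.1 := fun h => by have := hB.2 h.symm; omega
  have hnl : l.1 ≠ n.1 := fun h => by have := hB'.2 h.symm; omega
  have e1 : 2 * gromovProduct (φ (mk [l])) (φ (mk [m])) = norm (φ (mk [l])) := by omega
  have e2 : 2 * gromovProduct (φ (mk [l]))⁻¹ (φ (mk [n])) = norm (φ (mk [l])) := by omega
  -- Only two generators exist, so both neighbours of U come from the other one.
  have hmn : m.1 = n.1 := by omega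
  by_cases hmn' : m = n
  -- Here U and U⁻¹ would both share half of U's length with the same element, hence with each
  -- other, contradicting `hself`.
  · subst hmn'
    have := le_gromovProduct_trans (n := gromovProduct (φ (mk [l])) (φ (mk [m]))) le_rfl
      (z := (φ (mk [l]))⁻¹) (by rw [gromovProduct_comm _ (φ (mk [l]))⁻¹]; omega)
    omega
  · have hnm : φ (mk [n]) = (φ (mk [m]))⁻¹ := by
      rw [hinv, eq_flip_of_ne hmn.symm (Ne.symm hmn')]
    rw [hnm] at e2
    have e3 := hhalf m l hml.symm
    rw [gromovProduct_comm] at e3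
    set U := φ (mk [l]) with hU
    set W := φ (mk [m]) with hW
    obtain ⟨h, hh⟩ : ∃ h, h = gromovProduct U W := ⟨_, rfl⟩
    obtain ⟨-, -, t1⟩ := le_gromovProduct_iff.1 hh.le
    obtain ⟨-, -, t2⟩ := le_gromovProduct_iff.1 (show h ≤ gromovProduct U⁻¹ W⁻¹ by omega)
    have hUl : U.toWord.length = 2 * h := by change norm U = _; omega
    have hWl : 2 * h ≤ W.toWord.length := by change _ ≤ norm W; omega
    obtain ⟨p, hp⟩ : ∃ p, p = U.toWord.take h := ⟨_, rfl⟩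
    obtain ⟨t, ht⟩ : ∃ t, t = U.toWord.drop h := ⟨_, rfl⟩
    have hUpt : U.toWord = p ++ t := by rw [hp, ht, take_append_drop]
    have hpl : p.length = h := by rw [hp, length_take]; omega
    have htl : t.length = h := by rw [ht, length_drop]; omega
    have hWsuf : t <:+ W.toWord := by
      have a1 : FreeGroup.invRev t <+: W⁻¹.toWord := by
        rw [toWord_inv, hUpt, invRev_append, take_append_of_le_length (by simp [htl]),
          take_of_length_le (by simp [htl])] at t2
        rw [t2]
        exact take_prefix _ _
      obtain ⟨r, hr⟩ := a1
      refine ⟨FreeGroup.invRev r, ?_⟩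
      rw [toWord_inv] at hr
      rw [← invRev_invRev (L₁ := W.toWord), ← hr, invRev_append, invRev_invRev]
    obtain ⟨q, hq⟩ := hWsuf
    have hWp : p <+: q := by
      have : p <+: W.toWord := by rw [hp, t1]; exact take_prefix _ _
      rw [← hq] at this
      refine prefix_of_prefix_length_le this (prefix_append _ _) ?_
      have := congrArg length hq
      simp at this
      omega
    obtain ⟨r, rfl⟩ := hWp
    have hUm : U = mk p * mk t := by rw [mul_mk, ← hUpt, mk_toWord]
    have hWm : W = mk p * mk r * mk t := by rw [mul_mk, mul_mk, hq, mk_toWord]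
    -- Now U = p t and W = p r t with p and t of length h. Conjugating U and U⁻¹W by t gives t p and
    -- r, of total length smaller by at least 2h.
    have key := hmove l m (mk t) hml
    rw [← hU, ← hW] at key
    have k1 : mk t * U * (mk t)⁻¹ = mk (t ++ p) := by rw [hUm, ← mul_mk]; group
    have k2 : mk t * (U⁻¹ * W) * (mk t)⁻¹ = mk r := by rw [hUm, hWm]; group
    rw [k1, k2] at key
    have n1 := norm_mk_le (L₁ := t ++ p)
    have n2 := norm_mk_le (L₁ := r)
    have n3 : norm W = (p ++ r ++ t).length := by rw [hq]; rfl
    have n4 : norm U = 2 * h := hUl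
    have n5 : 0 < norm U := by
      rw [Nat.pos_iff_ne_zero, Ne, norm_eq_zero]
      exact hne l
    simp only [length_append] at n1 n3
    omega

/-- `Aut(F₂)` is generated, as a monoid, by inner automorphisms, sign changes, the exchange of the
generators, and one transvection. -/
theorem mulAut_mem_of_generators (G : Submonoid (MulAut (FreeGroup (Fin 2))))
    (hconj : ∀ c, MulAut.conj c ∈ G) (hsign : ∀ s, signAut s ∈ G) (hswap : swapAut ∈ G)
    (htrans : transvection 0 ∈ G) (φ : MulAut (FreeGroup (Fin 2))) : φ ∈ G := by
  induction hn : norm (φ (of 0)) + norm (φ (of 1)) using Nat.strong_induction_on generalizing φ with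
  | _ N ih
  by_contra hφ
  have hmin : ∀ ψ : MulAut (FreeGroup (Fin 2)), ψ ∉ G →
      norm (φ (of 0)) + norm (φ (of 1)) ≤ norm (ψ (of 0)) + norm (ψ (of 1)) := by
    intro ψ hψ
    by_contra! h
    exact hψ (ih _ (hn ▸ h) ψ rfl)
  have hnorm := norm_map_letter_eq φ.toMonoidHom
  simp only [MulEquiv.toMonoidHom_eq_coe, MonoidHom.coe_coe] at hnorm
  have htot : ∀ l m : Fin 2 × Bool, l.1 ≠ m.1 →
      norm (φ (mk [l])) + norm (φ (mk [m])) = norm (φ (of 0)) + norm (φ (of 1)) := by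
    intro l m h
    rw [hnorm, hnorm]
    obtain ⟨h1, h2⟩ | ⟨h1, h2⟩ : (l.1 = 0 ∧ m.1 = 1) ∨ (l.1 = 1 ∧ m.1 = 0) := by omega
    · rw [h1, h2]
    · rw [h1, h2, add_comm]
  have hmove : ∀ (l m : Fin 2 × Bool) (c : FreeGroup (Fin 2)), l.1 ≠ m.1 →
      norm (φ (mk [l])) + norm (φ (mk [m])) ≤ norm (c * φ (mk [l]) * c⁻¹) +
        norm (c * ((φ (mk [l]))⁻¹ * φ (mk [m])) * c⁻¹) := by
    intro l m c h
    obtain ⟨ν, h0, h1, hν⟩ := exists_signed_perm l m h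
    have hν := hν G hsign hswap
    -- This automorphism sends the basis to the pair on the right of `hmove`. Recovering `φ` from it
    -- uses only `transvection 0` itself, not its inverse, so `G` need only be a monoid.
    have := hmin (MulAut.conj c * φ * ν * (transvection 0)⁻¹) (by
      intro hmem
      apply hφ
      have := mul_mem (hconj c⁻¹) (mul_mem (mul_mem hmem htrans) hν)
      rw [_root_.map_inv] at this
      simpa [mul_assoc] using this)
    rw [htot l m h]
    simp only [MulAut.mul_apply, transvection_inv_of, MulAut.conj_apply, if_true,
      Fin.isValue, one_ne_zero, if_false, _root_.map_mul, _root_.map_inv, h0, h1] at this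
    have e : c * ((φ (mk [l]))⁻¹ * φ (mk [m])) * c⁻¹ =
        (c * φ (mk [l]) * c⁻¹)⁻¹ * (c * φ (mk [m]) * c⁻¹) := by group
    rw [e]
    exact this
  have hinv : ∀ l : Fin 2 × Bool, (φ (mk [l]))⁻¹ = φ (mk [(l.1, !l.2)]) := fun l => by
    rw [← mk_singleton_inv, _root_.map_inv]
  have hN := isNielsenReduced_of_minimal φ hmove
  -- The image of a reduced word is at least as long as the word, so the preimage of a generator is
  -- a single letter and `φ` is a signed permutation.
  have hletter : ∀ i : Fin 2, ∃ l, φ (mk [l]) = of i := by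
    intro i
    obtain ⟨g, hg⟩ := φ.surjective (of i)
    cases hL : g.toWord with
    | nil =>
      rw [toWord_eq_nil_iff] at hL
      rw [hL, _root_.map_one] at hg
      exact absurd hg (one_ne_of i)
    | cons l L =>
      have hr : IsReduced (l :: L) := hL ▸ isReduced_toWord
      have hgm : g = mk (l :: L) := by rw [← hL, mk_toWord]
      have := (hN.le_norm l L hr (l.1, !l.2) (fun h => by simpa using congrArg Prod.snd h)).2
      simp only [MulEquiv.toMonoidHom_eq_coe, MonoidHom.coe_coe] at this
      rw [← hgm, hg, norm_of] at this
      have hLn : L = [] := by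
        rw [← length_eq_zero_iff]
        simp only [length_cons] at this
        omega
      exact ⟨l, by rw [← hg, hgm, hLn]⟩
  obtain ⟨l, hl⟩ := hletter 0
  obtain ⟨m, hm⟩ := hletter 1
  have hlm : l.1 ≠ m.1 := by
    intro h
    by_cases h2 : l.2 = m.2
    · rw [Prod.ext h h2, hm] at hl
      exact absurd (of_injective hl) (by simp)
    · have : l = (m.1, !m.2) := eq_flip_of_ne h fun h' => h2 (congrArg Prod.snd h')
      rw [this, ← hinv, hm] at hl
      have := congrArg toWord hl
      simp [toWord_inv, FreeGroup.invRev] at this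
  obtain ⟨ν, h0, h1, hν⟩ := exists_signed_perm l m hlm
  apply hφ
  have : φ = ν⁻¹ := by
    rw [eq_inv_iff_mul_eq_one]
    refine MulEquiv.ext fun x => ?_
    change ((φ * ν : MulAut _) : FreeGroup (Fin 2) →* FreeGroup (Fin 2)) x = MonoidHom.id _ x
    congr 1
    ext j
    obtain rfl | rfl : j = 0 ∨ j = 1 := by omega
    · simp [h0, hl]
    · simp [h1, hm]
  rw [this]
  exact hν G hsign hswap

end Nielsen

end FreeGroup

/-! ### Words with consistent signs and their conjugates -/

namespace FreeGroup

/-- The word obtained from `w` by giving every letter `i` the sign `s i`. -/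
def signedWord {α : Type*} (s : α → Bool) (w : List α) : List (α × Bool) :=
  w.map fun i => (i, s i)

/-- The element represented by `signedWord s w`. -/
def signedElt {α : Type*} (s : α → Bool) (w : List α) : FreeGroup α := mk (signedWord s w)

section Signed

variable {α : Type*} (s : α → Bool)

@[simp] theorem signedElt_nil : signedElt s [] = 1 := rfl

theorem signedElt_append (v w : List α) :
    signedElt s (v ++ w) = signedElt s v * signedElt s w := by
  simp [signedElt, signedWord]

theorem signedElt_cons (i : α) (w : List α) :
    signedElt s (i :: w) = mk [(i, s i)] * signedElt s w :=
  signedElt_append s [i] w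

theorem isCyclicallyReduced_signedWord (w : List α) :
    IsCyclicallyReduced (signedWord s w) := by
  have h : ∀ x ∈ signedWord s w, ∀ y ∈ signedWord s w, x.1 = y.1 → x.2 = y.2 := by
    simp only [signedWord, mem_map]
    rintro _ ⟨i, -, rfl⟩ _ ⟨j, -, rfl⟩ hij
    exact congrArg s hij
  refine ⟨?_, fun a ha b hb => h a (mem_of_getLast? ha) b (mem_of_head? hb)⟩
  rw [IsReduced, isChain_iff_forall_rel_of_append_cons_cons]
  intro a b l₁ l₂ hl
  exact h a (by simp [hl]) b (by simp [hl])

theorem reduceCyclically_of_isCyclicallyReduced [DecidableEq α] {L : List (α × Bool)}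
    (h : IsCyclicallyReduced L) : reduceCyclically L = L := by
  induction L using List.bidirectionalRec with
  | nil => simp
  | singleton => simp
  | cons_append a l b ih =>
    rw [reduceCyclically.cons_append, if_neg]
    · simp
    · have := (isCyclicallyReduced_cons_append_iff.1 h).2
      rintro ⟨h1, h2⟩
      rw [← this h1] at h2
      simp at h2

theorem reduceCyclically_conj [DecidableEq α] (k r : List (α × Bool))
    (h : IsCyclicallyReduced r) : reduceCyclically (k ++ r ++ invRev k) = r := by
  induction k with
  | nil => simpa using reduceCyclically_of_isCyclicallyReduced h
  | cons x k ih =>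
    rw [invRev_cons]
    have : x :: k ++ r ++ (FreeGroup.invRev k ++ FreeGroup.invRev [x]) =
        x :: ((k ++ r ++ FreeGroup.invRev k) ++ [(x.1, !x.2)]) := by
      simp [FreeGroup.invRev]
    rw [this, reduceCyclically.cons_append, if_pos (by simp), ih]

theorem isReduced_cons_append_flip {x : α × Bool} {R : List (α × Bool)} (hR : IsReduced R)
    (hne : R ≠ []) (h1 : ∀ y ∈ R.head?, y ≠ (x.1, !x.2)) (h2 : ∀ y ∈ R.getLast?, y ≠ x) :
    IsReduced (x :: R ++ [(x.1, !x.2)]) := by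
  refine isChain_append.2 ⟨isChain_cons.2 ⟨fun y hy hxy => ?_, hR⟩, isChain_singleton _, ?_⟩
  · by_contra h
    refine h1 y hy (eq_flip_of_ne hxy.symm fun h' => h (by rw [h']))
  · intro y hy z hz hyz
    obtain rfl : (x.1, !x.2) = z := by simpa using hz
    have hy' : y ∈ R.getLast? := by
      rwa [getLast?_cons_of_ne_nil hne] at hy
    by_contra h
    exact h2 y hy' (by simpa using eq_flip_of_ne hyz fun h' => h (by rw [h']))

/-- The reduced words of conjugates of an element given by a word with consistent signs. -/
theorem exists_conj_eq_mk [DecidableEq α] {p : List α} (hp : p ≠ []) (c : FreeGroup α) :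
    ∃ k p', p' ~r p ∧ IsReduced (k ++ signedWord s p' ++ FreeGroup.invRev k) ∧
      c * signedElt s p * c⁻¹ = mk (k ++ signedWord s p' ++ FreeGroup.invRev k) := by
  rw [← mk_toWord (x := c)]
  induction c.toWord with
  | nil =>
    refine ⟨[], p, .refl p, ?_, ?_⟩
    · simpa using (isCyclicallyReduced_signedWord s p).isReduced
    · simp [← one_eq_mk, signedElt]
  | cons x L ih =>
    obtain ⟨k, p', hr, hred, he⟩ := ih
    have he' : mk (x :: L) * signedElt s p * (mk (x :: L))⁻¹ =
        mk [x] * mk (k ++ signedWord s p' ++ FreeGroup.invRev k) * (mk [x])⁻¹ := by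
      rw [← he, mk_cons]; group
    rw [he']
    have hp' : p' ≠ [] := by
      rintro rfl
      exact hp (isRotated_nil_iff'.1 hr).symm
    -- The case where conjugation by `x` causes no cancellation. Otherwise it rotates the core if
    -- `k` is empty and removes the first letter of `k` if not.
    have extend : k ++ signedWord s p' ++ FreeGroup.invRev k ≠ [] →
        (∀ y ∈ (k ++ signedWord s p' ++ FreeGroup.invRev k).head?, y ≠ (x.1, !x.2)) →
        (∀ y ∈ (k ++ signedWord s p' ++ FreeGroup.invRev k).getLast?, y ≠ x) →
        ∃ k₁ p₁, p₁ ~r p ∧ IsReduced (k₁ ++ signedWord s p₁ ++ FreeGroup.invRev k₁) ∧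
          mk [x] * mk (k ++ signedWord s p' ++ FreeGroup.invRev k) * (mk [x])⁻¹ =
          mk (k₁ ++ signedWord s p₁ ++ FreeGroup.invRev k₁) := by
      intro h0 h1 h2
      refine ⟨x :: k, p', hr, ?_, ?_⟩
      · have := isReduced_cons_append_flip hred h0 h1 h2
        simpa [invRev_cons, FreeGroup.invRev] using this
      · rw [invRev_cons]
        simp only [← mul_mk, ← inv_mk, mk_cons x k]
        group
    cases k with
    | nil =>
      simp only [nil_append, invRev_empty, append_nil] at *
      by_cases h1 : ∀ y ∈ (signedWord s p').head?, y ≠ (x.1, !x.2)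
      · by_cases h2 : ∀ y ∈ (signedWord s p').getLast?, y ≠ x
        · exact extend (by simpa [signedWord] using hp') h1 h2
        · obtain ⟨q, j, rfl⟩ : ∃ q j, p' = q ++ [j] :=
            ⟨_, _, (dropLast_append_getLast hp').symm⟩
          have hj : (j, s j) = x := by simpa [signedWord] using h2
          refine ⟨[], j :: q, (isRotated_append (l := [j]) (l' := q)).trans hr, ?_, ?_⟩
          · simpa using (isCyclicallyReduced_signedWord s (j :: q)).isReduced
          · have e1 := signedElt_append s q [j]
            have e2 := signedElt_cons s j q
            have e3 : signedElt s [j] = mk [x] := by simp [signedElt, signedWord, hj]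
            rw [hj] at e2
            rw [e3] at e1
            rw [← signedElt, e1, nil_append, invRev_empty, append_nil, ← signedElt, e2]
            group
      · obtain ⟨j, q, rfl⟩ : ∃ j q, p' = j :: q := by
          cases p' with
          | nil => exact absurd rfl hp'
          | cons j q => exact ⟨j, q, rfl⟩
        have hj : (j, s j) = (x.1, !x.2) := by
          push Not at h1
          simpa [signedWord, Prod.ext_iff] using h1
        refine ⟨[], q ++ [j], (isRotated_append (l := q) (l' := [j])).trans hr, ?_, ?_⟩
        · simpa using (isCyclicallyReduced_signedWord s (q ++ [j])).isReduced
        · have e1 := signedElt_append s q [j]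
          have e2 := signedElt_cons s j q
          have e3 : signedElt s [j] = (mk [x])⁻¹ := by
            rw [mk_singleton_inv, ← hj]; rfl
          rw [hj, ← mk_singleton_inv] at e2
          rw [e3] at e1
          rw [← signedElt, e2, nil_append, invRev_empty, append_nil, ← signedElt, e1]
          group
    | cons y k =>
      by_cases hy : y = (x.1, !x.2)
      · refine ⟨k, p', hr, hred.infix ⟨[y], FreeGroup.invRev [y], ?_⟩, ?_⟩
        · rw [invRev_cons (L := k)]; simp
        · rw [invRev_cons]
          simp only [← mul_mk, ← inv_mk, mk_cons y k]
          rw [hy, ← mk_singleton_inv]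
          group
      · refine extend (by simp) (fun z hz => ?_) (fun z hz => ?_)
        · obtain rfl : y = z := by simpa using hz
          exact hy
        · rw [invRev_cons, ← append_assoc] at hz
          have hi : FreeGroup.invRev [y] = [(y.1, !y.2)] := rfl
          rw [hi, getLast?_concat] at hz
          obtain rfl : (y.1, !y.2) = z := by simpa using hz
          rintro rfl
          exact hy (by simp)

end Signed

/-! ### The automorphic orbit of a generator -/

section Orbit

/-- A conjugator common to all letters telescopes, so identities between substitutions need checking
on letters only. -/
theorem map_signedElt_flatMap {f : FreeGroup (Fin 2) →* FreeGroup (Fin 2)}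
    {s t : Fin 2 → Bool} {τ σ : Fin 2 → List (Fin 2)} {c : FreeGroup (Fin 2)}
    (h : ∀ i, f (signedElt s (τ i)) = c * signedElt t (σ i) * c⁻¹) (w : List (Fin 2)) :
    f (signedElt s (w.flatMap τ)) = c * signedElt t (w.flatMap σ) * c⁻¹ := by
  induction w with
  | nil => simp
  | cons i w ih =>
    rw [flatMap_cons, flatMap_cons, signedElt_append, signedElt_append, _root_.map_mul, h, ih]
    group

/-- Conjugates of positive primitive words with a choice of sign for each letter. -/
def IsSignedPrim (g : FreeGroup (Fin 2)) : Prop :=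
  ∃ c s p, PosPrim p ∧ g = c * signedElt s p * c⁻¹

theorem IsSignedPrim.map {f : MulAut (FreeGroup (Fin 2))}
    (h : ∀ s p, PosPrim p → IsSignedPrim (f (signedElt s p))) {g : FreeGroup (Fin 2)}
    (hg : IsSignedPrim g) : IsSignedPrim (f g) := by
  obtain ⟨c, s, p, hp, rfl⟩ := hg
  obtain ⟨d, t, q, hq, he⟩ := h s p hp
  refine ⟨f c * d, t, q, hq, ?_⟩
  rw [_root_.map_mul, _root_.map_mul, he, _root_.map_inv]
  group

theorem flatMap_singleton_id (w : List (Fin 2)) : w.flatMap (fun i => [i]) = w := by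
  induction w <;> simp_all

theorem map_swap_insertBefore (i : Fin 2) (w : List (Fin 2)) :
    (insertBefore i w).map (Equiv.swap 0 1) =
      insertBefore (Equiv.swap 0 1 i) (w.map (Equiv.swap 0 1)) := by
  induction w with
  | nil => rfl
  | cons c w ih =>
    by_cases h : c = i <;> simp [h, ih]

theorem _root_.PosPrim.map_swap {p : List (Fin 2)} (hp : PosPrim p) :
    PosPrim (p.map (Equiv.swap 0 1)) := by
  induction hp with
  | letter i => exact .letter _
  | subst i hp ih => rw [map_swap_insertBefore]; exact ih.subst _

theorem isSignedPrim_transvection_of_eq {s : Fin 2 → Bool} (hs : s 0 = s 1) {p : List (Fin 2)}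
    (hp : PosPrim p) : IsSignedPrim (transvection 0 (signedElt s p)) := by
  have key := fun c h => map_signedElt_flatMap (f := (transvection (0 : Fin 2)).toMonoidHom)
    (s := s) (t := s) (τ := fun i => [i]) (σ := fun i => if i = 0 then [i] else [0, i]) (c := c) h p
  rw [flatMap_singleton_id] at key
  cases h : s 1
  · refine ⟨of 0, s, _, hp.subst 0, key (of 0) fun i => ?_⟩
    obtain rfl | rfl : i = 0 ∨ i = 1 := by omega
    · simp [signedElt_cons, mk_letter, hs, h, transvection_of]
    · simp [signedElt_cons, mk_letter, hs, h, transvection_of]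
  · refine ⟨1, s, _, hp.subst 0, key 1 fun i => ?_⟩
    obtain rfl | rfl : i = 0 ∨ i = 1 := by omega
    · simp [signedElt_cons, mk_letter, hs, h, transvection_of]
    · simp [signedElt_cons, mk_letter, hs, h, transvection_of]

theorem insertBefore_one_map_swap (w : List (Fin 2)) :
    insertBefore 1 (w.map (Equiv.swap 0 1)) = w.flatMap fun i => if i = 0 then [1] else [1, 0] := by
  induction w with
  | nil => rfl
  | cons c w ih =>
    obtain rfl | rfl : c = 0 ∨ c = 1 := by omega
    · simp [ih]
    · simp [ih]

/-- With equal signs the transvection acts, up to conjugation, as `insertBefore 0`. With opposite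
signs, if `p` is an image of `insertBefore 0`, it undoes that substitution; if `p` is an image of
`insertBefore 1`, the composite becomes a swap followed by `insertBefore 1`, with both signs now
equal. -/
theorem isSignedPrim_transvection (s : Fin 2 → Bool) {p : List (Fin 2)}
    (hp : PosPrim p) : IsSignedPrim (transvection 0 (signedElt s p)) := by
  by_cases hs : s 0 = s 1
  · exact isSignedPrim_transvection_of_eq hs hp
  cases hp with
  | letter i =>
    exact isSignedPrim_transvection_of_eq (s := fun _ => s i) rfl (.letter i)
  | subst i hp =>
    rename_i p
    have key := fun t c σ h => map_signedElt_flatMap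
      (f := (transvection (0 : Fin 2)).toMonoidHom)
      (s := s) (t := t) (τ := fun j => if j = i then [j] else [i, j]) (σ := σ) (c := c) h p
    obtain rfl | rfl : i = 0 ∨ i = 1 := by omega
    · have key := fun c h => key s c (fun j => [j]) h
      rw [flatMap_singleton_id] at key
      cases h : s 1
      · have h0 : s 0 = true := by simpa [h] using hs
        refine ⟨of 0, s, p, hp, key (of 0) fun j => ?_⟩
        obtain rfl | rfl : j = 0 ∨ j = 1 := by omega
        · simp [signedElt_cons, mk_letter, h0, transvection_of]
        · simp [signedElt_cons, mk_letter, h0, h, transvection_of, mul_assoc]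
      · have h0 : s 0 = false := by simpa [h] using hs
        refine ⟨1, s, p, hp, key 1 fun j => ?_⟩
        obtain rfl | rfl : j = 0 ∨ j = 1 := by omega
        · simp [signedElt_cons, mk_letter, h0, transvection_of]
        · simp [signedElt_cons, mk_letter, h0, h, transvection_of]
    · have key := fun t c h => key t c (fun i => if i = 0 then [1] else [1, 0]) h
      rw [← insertBefore_one_map_swap] at key
      cases h : s 1
      · have h0 : s 0 = true := by simpa [h] using hs
        refine ⟨1, fun _ => false, _, hp.map_swap.subst 1, key (fun _ => false) 1 fun j => ?_⟩
        obtain rfl | rfl : j = 0 ∨ j = 1 := by omega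
        · simp [signedElt_cons, mk_letter, h0, h, transvection_of]
        · simp [signedElt_cons, mk_letter, h, transvection_of]
      · have h0 : s 0 = false := by simpa [h] using hs
        refine ⟨of 0, fun _ => true, _, hp.map_swap.subst 1,
          key (fun _ => true) (of 0) fun j => ?_⟩
        obtain rfl | rfl : j = 0 ∨ j = 1 := by omega
        · simp [signedElt_cons, mk_letter, h0, h, transvection_of]
        · simp [signedElt_cons, mk_letter, h, transvection_of, mul_assoc]

/-- Every primitive element of `F₂` is conjugate to a positive primitive word with signs. -/
theorem isSignedPrim_map_of (φ : MulAut (FreeGroup (Fin 2))) : IsSignedPrim (φ (of 0)) := by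
  let G : Submonoid (MulAut (FreeGroup (Fin 2))) :=
    { carrier := {f | ∀ g, IsSignedPrim g → IsSignedPrim (f g)}
      mul_mem' := fun {a b} ha hb g hg => ha _ (hb _ hg)
      one_mem' := fun g hg => hg }
  have hφ : φ ∈ G := by
    refine mulAut_mem_of_generators G ?_ ?_ ?_ ?_ φ
    · rintro c _ ⟨d, s, p, hp, rfl⟩
      refine ⟨c * d, s, p, hp, ?_⟩
      simp only [MulAut.conj_apply]
      group
    · refine fun t g => IsSignedPrim.map fun s p hp => ?_
      refine ⟨1, fun i => t i == s i, p, hp, ?_⟩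
      have := map_signedElt_flatMap (f := (signAut t).toMonoidHom) (s := s)
        (t := fun i => t i == s i) (τ := fun i => [i]) (σ := fun i => [i]) (c := 1) (fun i => by
          cases h1 : s i <;> cases h2 : t i <;>
            simp [signedElt_cons, mk_letter, h1, h2, signAut_of]) p
      rwa [flatMap_singleton_id] at this
    · refine fun g => IsSignedPrim.map fun s p hp => ?_
      refine ⟨1, fun i => s (Equiv.swap 0 1 i), _, hp.map_swap, ?_⟩
      have := map_signedElt_flatMap (f := swapAut.toMonoidHom) (s := s)
        (t := fun i => s (Equiv.swap 0 1 i)) (τ := fun i => [i])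
        (σ := fun i => [Equiv.swap 0 1 i]) (c := 1) (fun i => by
          cases h1 : s i <;> simp [signedElt_cons, mk_letter, h1, swapAut_of]) p
      rwa [flatMap_singleton_id, ← map_eq_flatMap] at this
    · exact fun g => IsSignedPrim.map fun s p hp => isSignedPrim_transvection s hp
  exact hφ _ ⟨1, fun _ => true, [0], .letter 0, by simp [signedElt, signedWord, of]⟩

theorem exists_map_of_eq_insertBefore (i : Fin 2) {p : List (Fin 2)}
    (h : ∃ φ : MulAut (FreeGroup (Fin 2)), φ (of 0) = signedElt (fun _ => true) p) :
    ∃ φ : MulAut (FreeGroup (Fin 2)),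
      φ (of 0) = signedElt (fun _ => true) (insertBefore i p) := by
  obtain ⟨φ, hφ⟩ := h
  refine ⟨transvection i * φ, ?_⟩
  have := map_signedElt_flatMap (f := (transvection i).toMonoidHom) (s := fun _ => true)
    (t := fun _ => true) (τ := fun j => [j]) (σ := fun j => if j = i then [j] else [i, j])
    (c := 1) (fun j => by
      by_cases h : j = i <;> simp [signedElt_cons, mk_letter, h, transvection_of]) p
  rw [flatMap_singleton_id] at this
  rw [one_mul, inv_one, mul_one] at this
  rw [MulAut.mul_apply, hφ]
  exact this

/-- For a letter i and the other letter j, all words i^k j are primitive, and substitutions carry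
this family along. This places arbitrarily high powers of `p` inside primitive words. -/
theorem _root_.PosPrim.exists_pow_append {p : List (Fin 2)} (hp : PosPrim p) :
    ∃ q, ∀ k : ℕ, ∃ φ : MulAut (FreeGroup (Fin 2)),
      φ (of 0) = signedElt (fun _ => true) ((replicate k p).flatten ++ q) := by
  induction hp with
  | letter i =>
    refine ⟨[Equiv.swap 0 1 i], fun k => ?_⟩
    induction k with
    | zero =>
      obtain rfl | rfl : i = 0 ∨ i = 1 := by omega
      · exact ⟨swapAut, by simp [signedElt_cons, mk_letter, swapAut_of]⟩
      · exact ⟨1, by simp [signedElt_cons, mk_letter]⟩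
    | succ k ih =>
      have h1 : insertBefore i ((replicate k [i]).flatten ++ [Equiv.swap 0 1 i]) =
          (replicate (k + 1) [i]).flatten ++ [Equiv.swap 0 1 i] := by
        have h2 : Equiv.swap 0 1 i ≠ i := by
          obtain rfl | rfl : i = 0 ∨ i = 1 := by omega
          all_goals simp
        rw [insertBefore_append, insertBefore_pow, replicate_succ', flatten_append]
        simp [h2]
      rw [← h1]
      exact exists_map_of_eq_insertBefore i ih
  | subst i hp ih =>
    obtain ⟨q, hq⟩ := ih
    refine ⟨insertBefore i q, fun k => ?_⟩
    rw [← insertBefore_pow, ← insertBefore_append]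
    exact exists_map_of_eq_insertBefore i (hq k)

/-- No letter occurs with both signs. -/
def SignConsistent {α : Type*} (L : List (α × Bool)) : Prop :=
  ∀ x ∈ L, ∀ y ∈ L, x.1 = y.1 → x.2 = y.2

theorem signConsistent_iff {α : Type*} {L : List (α × Bool)} :
    SignConsistent L ↔ ∃ s, L = signedWord s (L.map Prod.fst) := by
  constructor
  · intro h
    classical
    refine ⟨fun i => decide ((i, true) ∈ L), ?_⟩
    rw [signedWord, map_map]
    conv_lhs => rw [← map_id L]
    refine map_congr_left fun x hx => Prod.ext rfl ?_
    obtain ⟨i, b⟩ := x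
    cases b
    · have : (i, true) ∉ L := fun h' => by simpa using h _ hx _ h' rfl
      simp [this]
    · simp [hx]
  · rintro ⟨s, hs⟩ x hx y hy hxy
    rw [hs, signedWord, mem_map] at hx hy
    obtain ⟨i, -, rfl⟩ := hx
    obtain ⟨j, -, rfl⟩ := hy
    exact congrArg s hxy

/-- A factor of p^k lies in the signed primitive word p^k q, which is cyclically reduced.
Conversely, the cyclic reduction of a primitive element is a signed rotation of some positive
primitive p. -/
theorem isPrimitivityBlocking_iff (u : FreeGroup (Fin 2)) :
    IsPrimitivityBlocking u ↔
      ¬ (SignConsistent u.toWord ∧ IsPrimFactor (u.toWord.map Prod.fst)) := by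
  rw [iff_not_comm, IsPrimitivityBlocking, IsOrbitBlocking]
  push Not
  constructor
  · rintro ⟨hs, p, hp, k, hk⟩
    obtain ⟨s, hs⟩ := signConsistent_iff.1 hs
    obtain ⟨q, hq⟩ := hp.exists_pow_append
    obtain ⟨φ, hφ⟩ := hq k
    refine ⟨signAut s * φ, ?_⟩
    have := map_signedElt_flatMap (f := (signAut s).toMonoidHom) (s := fun _ => true)
        (t := s) (τ := fun i => [i]) (σ := fun i => [i]) (c := 1) (fun i => by
          cases h2 : s i <;>
            simp [signedElt_cons, mk_letter, h2, signAut_of]) ((replicate k p).flatten ++ q)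
    rw [flatMap_singleton_id, one_mul, inv_one, mul_one] at this
    have h2 : (signAut s * φ) (of 0) = signedElt s ((replicate k p).flatten ++ q) := by
      rw [MulAut.mul_apply, hφ]
      exact this
    change _ <:+: reduceCyclically ((signAut s * φ) (of 0)).toWord
    have h3 := isCyclicallyReduced_signedWord s ((replicate k p).flatten ++ q)
    rw [h2, signedElt, toWord_mk_of_isReduced h3.isReduced,
      reduceCyclically_of_isCyclicallyReduced h3, hs]
    exact (hk.trans (prefix_append _ _).isInfix).map _
  · rintro ⟨φ, hφ⟩
    obtain ⟨c, s, p, hp, he⟩ := isSignedPrim_map_of φ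
    obtain ⟨k, p', hr, hred, he'⟩ := exists_conj_eq_mk s hp.ne_nil c
    rw [he, he', toWord_mk_of_isReduced hred,
      reduceCyclically_conj _ _ (isCyclicallyReduced_signedWord s p')] at hφ
    have hfst : (signedWord s p').map Prod.fst = p' := by
      rw [signedWord, map_map]
      exact map_id p'
    constructor
    · intro x hx y hy
      exact (signConsistent_iff.2 ⟨s, by rw [hfst]⟩ : SignConsistent (signedWord s p')) x
        (hφ.subset hx) y (hφ.subset hy)
    -- Every rotation of `p` is a factor of p².
    · refine ⟨p, hp, 2, ?_⟩
      have h1 := hφ.map Prod.fst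
      rw [hfst] at h1
      refine h1.trans ?_
      obtain ⟨n, hn⟩ := hr.symm
      rw [← hn, rotate_eq_drop_append_take_mod]
      refine ⟨p.take (n % p.length), p.drop (n % p.length), ?_⟩
      rw [← append_assoc, take_append_drop, append_assoc, take_append_drop]
      simp [replicate_succ]

end Orbit

end FreeGroup

/-! ### The stack machine -/

namespace BlockingMachine

/-- The stacks: `input` and `store` hold letters, `output` holds the answer. -/
inductive Stack
  | input | store | output
  deriving DecidableEq

instance : Fintype Stack := ⟨{.input, .store, .output}, fun k => by cases k <;> simp⟩

/-- The labels: `scan` moves the word from `input` to `store` while collecting information,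
`rewrite` moves it back while trimming blocks, and `drain` empties `store`. -/
inductive Label
  | scan | rewrite | drain
  deriving DecidableEq

instance : Fintype Label := ⟨{.scan, .rewrite, .drain}, fun l => by cases l <;> simp⟩

/-- The letters `a^{±1}`, `b^{±1}`. -/
abbrev Letter := Fin 2 × Bool

/-- The stack alphabets. -/
abbrev alphabet : Stack → Type
  | .input => Letter
  | .store => Letter
  | .output => Bool

/-- The finite memory: the last two letters read, the letters seen, the indices `i` for which `i i`
was seen, and the answer. -/
structure Memory where
  prev : Option Letter
  cur : Option Letter
  seen : Letter → Bool
  rep : Fin 2 → Bool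
  answer : Bool

instance : Finite Memory :=
  Finite.of_injective (fun v : Memory => (v.prev, v.cur, v.seen, v.rep, v.answer)) (by
    rintro ⟨⟩ ⟨⟩ h
    simpa using h)

noncomputable instance : Fintype Memory := Fintype.ofFinite _

/-- The initial memory. -/
def start : Memory := ⟨none, none, fun _ => false, fun _ => false, false⟩

/-- Remember the letter just read. -/
def shift (v : Memory) (c : Option Letter) : Memory := { v with prev := v.cur, cur := c }

/-- Record the letter `c` read during a scan. -/
def record (v : Memory) (c : Letter) : Memory where
  prev := v.cur
  cur := some c
  seen x := v.seen x || decide (x = c)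
  rep i := v.rep i || (decide (v.cur.map Prod.fst = some i) && decide (c.1 = i))
  answer := v.answer

/-- The memory after a pop during a scan. -/
def scanRead (v : Memory) (c : Option Letter) : Memory := c.elim (shift v none) (record v)

/-- A letter was seen with both signs, or both squares of letters were seen. -/
def rejects (v : Memory) : Bool :=
  (v.seen (0, false) && v.seen (0, true)) || (v.seen (1, false) && v.seen (1, true)) ||
    (v.rep 0 && v.rep 1)

/-- The letter just read is the last one of a block to be trimmed. -/
def trims (v : Memory) : Bool :=
  v.cur.any fun c => v.rep c.1 && !decide (v.prev.map Prod.fst = some c.1)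

/-- The letter just read. -/
def letter (v : Memory) : Letter := v.cur.getD (0, false)

open Turing.TM2.Stmt in
/-- The program. -/
def program : Label → Turing.TM2.Stmt alphabet Label Memory
  | .scan =>
    pop .input scanRead <|
    branch (fun v => v.cur.isSome)
      (push .store letter <| goto fun _ => .scan)
      (branch rejects (load (fun v => { v with answer := true }) <| goto fun _ => .drain)
        (branch (fun v => v.rep 0 || v.rep 1) (goto fun _ => .rewrite) (goto fun _ => .drain)))
  | .rewrite =>
    pop .store shift <|
    branch (fun v => v.cur.isSome)
      (branch trims (goto fun _ => .rewrite) (push .input letter <| goto fun _ => .rewrite))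
      (load (fun _ => start) <| goto fun _ => .scan)
  | .drain =>
    pop .store shift <|
    branch (fun v => v.cur.isSome)
      (goto fun _ => .drain)
      (push .output Memory.answer <| load (fun _ => start) halt)

/-- The stack contents. -/
def contents (a b : List Letter) (o : List Bool) : ∀ k, List (alphabet k)
  | .input => a
  | .store => b
  | .output => o

@[simp] theorem update_input (a b o a') :
    Function.update (contents a b o) .input a' = contents a' b o := by
  funext k; cases k <;> rfl

@[simp] theorem update_store (a b o b') :
    Function.update (contents a b o) .store b' = contents a b' o := by
  funext k; cases k <;> rfl

@[simp] theorem update_output (a b o o') :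
    Function.update (contents a b o) .output o' = contents a b o' := by
  funext k; cases k <;> rfl

@[simp] theorem stacks_input (a b o) : contents a b o .input = a := rfl
@[simp] theorem stacks_store (a b o) : contents a b o .store = b := rfl
@[simp] theorem stacks_output (a b o) : contents a b o .output = o := rfl

/-- The configurations of the machine. -/
abbrev Config := Turing.TM2.Cfg alphabet Label Memory

/-- `d` is reached from `c` in at most `n` steps. -/
def ReachesIn (n : ℕ) (c d : Config) : Prop :=
  ∃ k ≤ n, (flip bind (Turing.TM2.step program))^[k] (some c) = some d

theorem ReachesIn.refl (c : Config) : ReachesIn 0 c c := ⟨0, le_rfl, rfl⟩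

theorem ReachesIn.trans {m n : ℕ} {c d e : Config} (h1 : ReachesIn m c d)
    (h2 : ReachesIn n d e) : ReachesIn (m + n) c e := by
  obtain ⟨k, hk, h1⟩ := h1
  obtain ⟨l, hl, h2⟩ := h2
  exact ⟨l + k, by omega, by rw [Function.iterate_add_apply, h1, h2]⟩

theorem ReachesIn.single {c d : Config} (h : Turing.TM2.step program c = some d) :
    ReachesIn 1 c d := ⟨1, le_rfl, h⟩

theorem ReachesIn.mono {m n : ℕ} {c d : Config} (h : ReachesIn m c d) (hmn : m ≤ n) :
    ReachesIn n c d := by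
  obtain ⟨k, hk, h⟩ := h
  exact ⟨k, hk.trans hmn, h⟩

/-! ### Step counts of the three phases -/

theorem scan_word (v : Memory) (w b : List Letter) :
    ReachesIn w.length ⟨some .scan, v, contents w b []⟩
      ⟨some .scan, w.foldl record v, contents [] (w.reverse ++ b) []⟩ := by
  induction w generalizing v b with
  | nil => exact .refl _
  | cons c w ih =>
    have h1 : ReachesIn 1 ⟨some .scan, v, contents (c :: w) b []⟩
        ⟨some .scan, record v c, contents w (c :: b) []⟩ := by
      apply ReachesIn.single
      simp [program, scanRead, record, letter]
    have := h1.trans (ih (record v c) (c :: b))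
    simpa [add_comm] using this

theorem drain_word (v : Memory) (b : List Letter) :
    ReachesIn (b.length + 1) ⟨some .drain, v, contents [] b []⟩
      ⟨none, start, contents [] [] [v.answer]⟩ := by
  induction b generalizing v with
  | nil =>
    apply ReachesIn.single
    simp [program, shift]
  | cons c b ih =>
    have h1 : ReachesIn 1 ⟨some .drain, v, contents [] (c :: b) []⟩
        ⟨some .drain, shift v (some c), contents [] b []⟩ := by
      apply ReachesIn.single
      simp [program, shift]
    have := h1.trans (ih (shift v (some c)))
    simpa [add_comm, shift] using this

/-- Popping `store` reads the word backwards, so the right neighbour of a letter is the one read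
just before it. The finite memory therefore suffices to find block ends, and pushing restores the
original order. Here `s` is the part already read, deleted letters included. -/
theorem rewrite_word (i : Fin 2) (v : Memory) (hv : ∀ j, v.rep j = true ↔ j = i)
    (r s : List Letter) (hs : v.cur = s.head?) :
    ReachesIn (r.length + 1) ⟨some .rewrite, v, contents (trimBlocks Prod.fst i s) r []⟩
      ⟨some .scan, start, contents (trimBlocks Prod.fst i (r.reverse ++ s)) [] []⟩ := by
  induction r generalizing v s with
  | nil =>
    apply ReachesIn.single
    simp [program, shift]
  | cons c r ih =>
    have h1 : ReachesIn 1 ⟨some .rewrite, v, contents (trimBlocks Prod.fst i s) (c :: r) []⟩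
        ⟨some .rewrite, shift v (some c), contents (trimBlocks Prod.fst i (c :: s)) r []⟩ := by
      apply ReachesIn.single
      by_cases hc : c.1 = i ∧ s.head?.map Prod.fst ≠ some i
      · have ht : trims (shift v (some c)) = true := by
          simp only [trims, shift, Option.any_some, hs, hc.1, (hv i).2 rfl, Bool.true_and,
            Bool.not_eq_true', decide_eq_false_iff_not]
          exact hc.2
        rw [trimBlocks, if_pos hc]
        simp only [program, Turing.TM2.step, Turing.TM2.stepAux, stacks_store, head?_cons, tail_cons,
          update_store, ht, cond_true]
        simp [shift]
      · have ht : trims (shift v (some c)) = false := by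
          rw [Bool.eq_false_iff]
          simp only [trims, shift, Option.any_some, hs]
          intro h
          rw [Bool.and_eq_true, hv, Bool.not_eq_true', decide_eq_false_iff_not] at h
          exact hc ⟨h.1, by rw [← h.1]; exact h.2⟩
        rw [trimBlocks, if_neg hc]
        simp only [program, Turing.TM2.step, Turing.TM2.stepAux, stacks_store, head?_cons, tail_cons,
          update_store, ht, cond_false, stacks_input, update_input]
        simp [shift, letter]
    have := h1.trans (ih (shift v (some c)) hv (c :: s) rfl)
    simpa [add_comm] using this

/-! ### Information gathered by a scan, correctness and running time -/

theorem foldl_record_seen (v : Memory) (w : List Letter) (x : Letter) :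
    (w.foldl record v).seen x = true ↔ v.seen x = true ∨ x ∈ w := by
  induction w generalizing v with
  | nil => simp
  | cons c w ih => simp [ih, record, or_assoc]

theorem foldl_record_rep (v : Memory) (w : List Letter) (i : Fin 2) :
    (w.foldl record v).rep i = true ↔
      v.rep i = true ∨ [i, i] <:+: (v.cur.toList ++ w).map Prod.fst := by
  induction w generalizing v with
  | nil =>
    have : ¬ [i, i] <:+: (v.cur.toList ++ []).map Prod.fst := by
      intro h
      have := h.length_le
      cases hc : v.cur <;> simp [hc] at this
    simp only [foldl_nil, this, or_false]
  | cons c w ih =>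
    rw [foldl_cons, ih]
    cases hc : v.cur with
    | none => simp [record, hc]
    | some x =>
      have : [i, i] <:+: ((some x).toList ++ c :: w).map Prod.fst ↔
          (x.1 = i ∧ c.1 = i) ∨ [i, i] <:+: (c :: w).map Prod.fst := by
        rw [Option.toList_some, singleton_append, map_cons, infix_cons_iff, map_cons,
          cons_prefix_cons, cons_prefix_cons]
        simp only [nil_prefix, and_true, eq_comm]
      rw [this]
      simp [record, hc, or_assoc]

theorem foldl_record_answer (v : Memory) (w : List Letter) :
    (w.foldl record v).answer = v.answer := by
  induction w generalizing v with
  | nil => rfl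
  | cons c w ih => rw [foldl_cons, ih]; rfl

theorem signConsistent_iff_forall {w : List Letter} :
    FreeGroup.SignConsistent w ↔ ∀ i : Fin 2, ¬ ((i, false) ∈ w ∧ (i, true) ∈ w) := by
  constructor
  · rintro h i ⟨h1, h2⟩
    simpa using h _ h1 _ h2 rfl
  · rintro h ⟨i, b⟩ hx ⟨j, c⟩ hy rfl
    have := h i
    cases b <;> cases c <;> simp_all

/-- From the input `w` the machine halts within `2 (|w| + 1)²` steps with the answer whether `w` is
not a factor of a power of a positive primitive word with signs. -/
theorem reaches_answer (w : List Letter) :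
    ∃ b : Bool, (b = true ↔
        ¬ (FreeGroup.SignConsistent w ∧ IsPrimFactor (w.map Prod.fst))) ∧
      ReachesIn (2 * (w.length + 1) ^ 2) ⟨some .scan, start, contents w [] []⟩
        ⟨none, start, contents [] [] [b]⟩ := by
  induction hn : w.length using Nat.strong_induction_on generalizing w with
  | _ n ih
  subst hn
  have hscan := scan_word start w []
  rw [append_nil] at hscan
  obtain ⟨v, hv⟩ : ∃ v, v = w.foldl record start := ⟨_, rfl⟩
  rw [← hv] at hscan
  have hseen : ∀ x, v.seen x = true ↔ x ∈ w := fun x => by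
    rw [hv, foldl_record_seen]; simp [start]
  have hrep : ∀ i, v.rep i = true ↔ [i, i] <:+: w.map Prod.fst := fun i => by
    rw [hv, foldl_record_rep]; simp [start]
  have hans : v.answer = false := by rw [hv, foldl_record_answer]; rfl
  have hrej : rejects v = true ↔ ¬ FreeGroup.SignConsistent w ∨
      ([0, 0] <:+: w.map Prod.fst ∧ [1, 1] <:+: w.map Prod.fst) := by
    simp only [rejects, Bool.or_eq_true, Bool.and_eq_true, hseen, hrep, signConsistent_iff_forall,
      Fin.forall_fin_two]
    tauto
  have hrej' : rejects (shift v none) = rejects v := rfl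
  have hfinish : ∀ v' : Memory, ReachesIn 1 ⟨some .scan, v, contents [] w.reverse []⟩
      ⟨some .drain, v', contents [] w.reverse []⟩ →
      ReachesIn (2 * (w.length + 1) ^ 2) ⟨some .scan, start, contents w [] []⟩
        ⟨none, start, contents [] [] [v'.answer]⟩ := fun v' h =>
    ((hscan.trans h).trans (drain_word v' w.reverse)).mono (by rw [length_reverse]; nlinarith)
  by_cases hr : rejects v = true
  · refine ⟨true, ?_, hfinish { shift v none with answer := true } (.single ?_)⟩
    · simp only [true_iff]
      rintro ⟨h1, h2⟩
      rcases hrej.1 hr with h | ⟨h, h'⟩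
      · exact h h1
      · exact h2.not_pair (by decide) h h'
    · simp only [program, Turing.TM2.step, Turing.TM2.stepAux, stacks_input, head?_nil, tail_nil,
        update_input, scanRead, Option.elim_none, hrej', hr]
      simp [shift]
  · have hcons : FreeGroup.SignConsistent w := by
      by_contra h
      exact hr (hrej.2 (.inl h))
    rw [Bool.not_eq_true] at hr
    by_cases hs : ∃ i, v.rep i = true
    · obtain ⟨i, hi⟩ := hs
      have hi' := (hrep i).1 hi
      have huniq : ∀ j, v.rep j = true ↔ j = i := by
        refine fun j => ⟨fun hj => ?_, fun hj => hj ▸ hi⟩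
        by_contra hne
        have : v.rep 0 = true ∧ v.rep 1 = true := by
          obtain ⟨rfl, rfl⟩ | ⟨rfl, rfl⟩ : (i = 0 ∧ j = 1) ∨ (i = 1 ∧ j = 0) := by omega
          · exact ⟨hi, hj⟩
          · exact ⟨hj, hi⟩
        rw [hrep, hrep] at this
        have h := hrej.2 (.inr this)
        rw [hr] at h
        exact absurd h (by decide)
      have hor : (v.rep 0 || v.rep 1) = true := by
        obtain rfl | rfl : i = 0 ∨ i = 1 := by omega
        · simp [hi]
        · simp [hi]
      have h1 : ReachesIn 1 ⟨some .scan, v, contents [] w.reverse []⟩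
          ⟨some .rewrite, shift v none, contents [] w.reverse []⟩ := by
        apply ReachesIn.single
        have hor' : ((shift v none).rep 0 || (shift v none).rep 1) = true := hor
        simp only [program, Turing.TM2.step, Turing.TM2.stepAux, stacks_input, head?_nil, tail_nil,
          update_input, scanRead, Option.elim_none, hrej', hr, hor']
        simp [shift]
      -- The failed pop has set `cur` to `none`, which marks the end of the word.
      have h2 := rewrite_word i (shift v none) huniq w.reverse [] rfl
      rw [reverse_reverse, append_nil] at h2
      obtain ⟨x, hx, hxi⟩ : ∃ x ∈ w, x.1 = i := by
        have : i ∈ w.map Prod.fst := hi'.subset (by simp)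
        simpa using this
      have hlt := length_trimBlocks_lt (f := Prod.fst) (i := i) ⟨x, hx, hxi⟩
      obtain ⟨b, hb, h3⟩ := ih _ hlt _ rfl
      refine ⟨b, ?_, ?_⟩
      · have hcons' : FreeGroup.SignConsistent (trimBlocks Prod.fst i w) := fun x hx y hy =>
          hcons x ((trimBlocks_sublist _ _ _).subset hx) y ((trimBlocks_sublist _ _ _).subset hy)
        rw [hb, trimBlocks_map, isPrimFactor_trimBlocks_iff hi' fun j hj h =>
          hj ((huniq j).1 ((hrep j).2 h))]
        simp [hcons, hcons']
      -- With n the length of `w`, this round costs at most 2n + 2 steps and the remaining rounds at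
      -- most 2n², as the trimmed word is strictly shorter; the sum is at most 2(n + 1)².
      · refine (((hscan.trans h1).trans h2).trans h3).mono ?_
        rw [length_reverse]
        nlinarith
    · push Not at hs
      refine ⟨false, ?_, hans ▸ hfinish (shift v none) (.single ?_)⟩
      · have := isPrimFactor_of_alternating fun j h => hs j ((hrep j).2 h)
        simp [hcons, this]
      · have hor : ((shift v none).rep 0 || (shift v none).rep 1) = false := by
          have h0 := hs 0
          have h1 := hs 1
          simp only [Bool.not_eq_true] at h0 h1
          simp [shift, h0, h1]
        simp only [program, Turing.TM2.step, Turing.TM2.stepAux, stacks_input, head?_nil, tail_nil,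
          update_input, scanRead, Option.elim_none, hrej', hr, hor]
        simp [shift]

/-- The machine as a bundled `Turing.FinTM2`. -/
noncomputable def machine : Turing.FinTM2 where
  K := Stack
  k₀ := .input
  k₁ := .output
  Γ := alphabet
  Λ := Label
  main := .scan
  σ := Memory
  initialState := start
  Γk₀Fin := inferInstanceAs (Fintype Letter)
  m := program

theorem initList_machine (w : List Letter) :
    Turing.initList machine w = ⟨some .scan, start, contents w [] []⟩ := by
  unfold Turing.initList
  congr
  funext k
  cases k <;> rfl

theorem haltList_machine (o : List Bool) :
    Turing.haltList machine o = ⟨none, start, contents [] [] o⟩ := by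
  unfold Turing.haltList
  congr
  funext k
  cases k <;> rfl

theorem nonempty_outputsInTime (w : List Letter) (b : Bool)
    (hb : b = true ↔ ¬ (FreeGroup.SignConsistent w ∧ IsPrimFactor (w.map Prod.fst))) :
    Nonempty (Turing.TM2OutputsInTime machine w (some [b]) (2 * (w.length + 1) ^ 2)) := by
  obtain ⟨b', hb', k, hk, h⟩ := reaches_answer w
  have : b' = b := by
    rw [Bool.eq_iff_iff, hb, hb']
  subst this
  refine ⟨⟨⟨k, ?_⟩, hk⟩⟩
  have key : ∀ c d : Config, c = Turing.initList machine w → d = Turing.haltList machine [b'] →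
      (flip bind (Turing.TM2.step program))^[k] (some c) = some d →
      (flip bind machine.step)^[k] (some (Turing.initList machine w)) =
        some (Turing.haltList machine [b']) := by
    rintro _ _ rfl rfl h
    exact h
  exact key _ _ (initList_machine w).symm (haltList_machine [b']).symm h

open Classical in
/-- The truth value of "`u` is primitivity-blocking". -/
noncomputable def blockingTest (u : FreeGroup (Fin 2)) : Bool := decide (IsPrimitivityBlocking u)

theorem blockingTest_eq_true_iff (u : FreeGroup (Fin 2)) :
    blockingTest u = true ↔ IsPrimitivityBlocking u := by
  simp [blockingTest]

/-- The machine decides primitivity-blocking in quadratic time. -/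
noncomputable def computableInTime : Turing.TM2ComputableInTime
    (fun u : FreeGroup (Fin 2) => u.toWord) Computability.encodeBool blockingTest where
  tm := machine
  inputAlphabet := Equiv.refl Letter
  outputAlphabet := Equiv.refl Bool
  time n := 2 * (n + 1) ^ 2
  outputsFun u := by
    have := (nonempty_outputsInTime u.toWord (blockingTest u)
      (by rw [blockingTest_eq_true_iff, FreeGroup.isPrimitivityBlocking_iff])).some
    have key : ∀ L : List Letter, L = u.toWord → Turing.TM2OutputsInTime machine L
        (some [blockingTest u]) (2 * (u.toWord.length + 1) ^ 2) := by
      rintro _ rfl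
      exact this
    exact key _ (map_id _)

theorem isBigO_time :
    Asymptotics.IsBigO Filter.atTop (fun n : ℕ => ((2 * (n + 1) ^ 2 : ℕ) : ℝ))
      (fun n : ℕ => (n : ℝ) ^ 2) := by
  -- For n ≥ 1, n + 1 ≤ 2n, whence 2(n + 1)² ≤ 8n².
  refine Asymptotics.IsBigO.of_bound 8 ?_
  filter_upwards [Filter.eventually_ge_atTop 1] with n hn
  have : (1 : ℝ) ≤ n := by exact_mod_cast hn
  rw [Real.norm_of_nonneg (by positivity), Real.norm_of_nonneg (by positivity)]
  push_cast
  nlinarith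

end BlockingMachine

/-- There is a Turing machine with finitely many stacks (half-tapes) over finite alphabets which,
started with the reduced word of an element `u` of `F_2` (over the four letters `a^{±1}`, `b^{±1}`),
halts with output the truth value of "`u` is primitivity-blocking", and whose number of steps on
each input of length `n` is at most `M.time n`, where `M.time n = O(n ^ 2)`. -/
theorem theorem5p5 :
    ∃ test : FreeGroup (Fin 2) → Bool,
      (∀ u : FreeGroup (Fin 2), test u = true ↔ IsPrimitivityBlocking u) ∧
      ∃ M : Turing.TM2ComputableInTime
          (fun u : FreeGroup (Fin 2) => u.toWord) Computability.encodeBool test,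
        (∀ k : M.tm.K, Finite (M.tm.Γ k)) ∧
        Asymptotics.IsBigO Filter.atTop
          (fun n : ℕ => (M.time n : ℝ)) (fun n : ℕ => (n : ℝ) ^ 2) := by
  refine ⟨BlockingMachine.blockingTest, BlockingMachine.blockingTest_eq_true_iff,
    BlockingMachine.computableInTime, ?_, BlockingMachine.isBigO_time⟩
  intro k
  change Finite (BlockingMachine.alphabet k)
  cases k <;> infer_instance
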